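/- Let $k\ge 0$ be an integer (the level), $\kappa=k+4$, $q=e^{i\pi/\kappa}$ and $n_q=\frac{q^n-q^{-n}}{q-q^{-1}}$ for $n\in\mathbb Z$. The integrable irreducible representations of $\mathrm{SU}(4)$ at level $k$ are labelled by the triples $m=(m_1,m_2,m_3)$ of non-negative integers (Dynkin labels of the highest weight) with $m_1+m_2+m_3\le k$. The quantum dimension of $m$ is given by the quantum Weyl formula $$\dim(m)=\prod_{\alpha>0}\frac{\langle m+\rho,\alpha\rangle_q}{\langle\rho,\alpha\rangle_q},$$ where $\alpha$ runs over the six positive roots of $A_3$ and $\rho=(1,1,1)$ is the Weyl vector, and the quantum cardinality is $|\mathcal A_k(\mathrm{SU}(4))|=\sum_m \dim(m)^2$, the sum being over all integrable irreducible representations at level $k$. Let $s$ be the modular matrix given by the Kac–Peterson formula $$s_{mn}=\frac{i^{6}\sqrt{\Delta}}{\kappa^{3/2}}\sum_{w\in S_4}\epsilon_w\, e^{-2i\pi\langle w(m+\rho),\,n+\rho\rangle/\kappa},$$ where $S_4$ is the Weyl group of $\mathrm{SU}(4)$, $\epsilon_w$ is the signature of $w$, the scalar product of weights is given by the inverse of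 the Cartan matrix of $A_3$ and $\Delta=\frac14$ is the determinant of this inverse; the index $0$ stands for the trivial representation $(0,0,0)$. Then, for every $k\ge 0$, $$|\mathcal A_k(\mathrm{SU}(4))|=\frac1{s_{00}^2}=\frac{4(k+4)^3}{2^{16}\cos^4\!\left(\frac{\pi}{k+4}\right)\left(2\cos\!\left(\frac{2\pi}{k+4}\right)+1\right)^2\sin^{12}\!\left(\frac{\pi}{k+4}\right)}.$$ In particular $|\mathcal A_4|=128(3+2\sqrt2)$, $|\mathcal A_6|=800(9+4\sqrt5)$ and $|\mathcal A_8|=3456(26+15\sqrt3)$. -/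

import Mathlib

namespace SU4

/-- An integral weight of `A₃ = su(4)`, given by its Dynkin labels, that is, by its components in
the basis of fundamental weights. -/
abbrev Weight := Fin 3 → ℤ

/-- The Weyl vector `ρ = {1,1,1}`. -/
def rho : Weight := fun _ => 1

/-- The fundamental quadratic form of `A₃`: the inverse of the Cartan matrix, i.e. the Gram matrix
of the fundamental weights. -/
noncomputable def Q : Matrix (Fin 3) (Fin 3) ℝ :=
  !![3/4, 1/2, 1/4; 1/2, 1, 1/2; 1/4, 1/2, 3/4]

theorem Q_mul_cartan : Q * (CartanMatrix.A 3).map (Int.cast : ℤ → ℝ) = 1 := by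
  have h : CartanMatrix.A 3 = !![2, -1, 0; -1, 2, -1; 0, -1, 2] := by decide
  rw [h]
  ext i j
  fin_cases i <;> fin_cases j <;> simp [Q, Matrix.mul_apply, Fin.sum_univ_three] <;> norm_num

/-- The coordinates of a weight in `ℝ⁴`, where `su(4)` has the roots `e_a - e_b` and the weight
space is the hyperplane of vectors with coordinate sum `0`. (The labels `λ₁, λ₂, λ₃` are
`l 0, l 1, l 2`.) -/
noncomputable def coord (l : Weight) (a : Fin 4) : ℝ :=
  (∑ s : Fin 3 with a ≤ s.castSucc, (l s : ℝ)) - (1 / 4) * ∑ s : Fin 3, ((s : ℝ) + 1) * (l s : ℝ)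

/-- The scalar product of vectors of `ℝ⁴`. -/
def dot (x y : Fin 4 → ℝ) : ℝ := ∑ a, x a * y a

theorem dot_coord (l m : Weight) :
    dot (coord l) (coord m) = ∑ i, ∑ j, (l i : ℝ) * Q i j * (m j : ℝ) := by
  simp [dot, coord, Finset.sum_filter, Fin.sum_univ_succ, Q, Fin.le_def]
  ring

/-- The pairing `⟨l, α⟩` of a weight with the root `α = e_a - e_b`, `a < b`. -/
def rootPairing (l : Weight) (a b : Fin 4) : ℤ :=
  ∑ s : Fin 3 with a ≤ s.castSucc ∧ s.castSucc < b, l s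

theorem rootPairing_eq (l : Weight) (a b : Fin 4) (h : a < b) :
    (rootPairing l a b : ℝ) = coord l a - coord l b := by
  revert h
  fin_cases a <;> fin_cases b <;>
    simp [rootPairing, coord, Finset.sum_filter, Fin.sum_univ_succ, Fin.le_def, Fin.lt_def]
  all_goals try ring

/-- The six positive roots `e_a - e_b`, `a < b`, of `A₃`, as pairs `(a, b)`. -/
def positiveRoots : Finset (Fin 4 × Fin 4) := Finset.univ.filter fun p => p.1 < p.2

/-- The integral weight with the non-negative Dynkin labels `m`. -/
def toWeight (m : Fin 3 → ℕ) : Weight := fun s => (m s : ℤ)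

/-- The integrable irreducible representations at level `k`, given by their highest weights: the
dominant integral weights `m` with `⟨m, θ⟩ = m₁ + m₂ + m₃ ≤ k`, `θ` the highest root. -/
def integrableIrreps (k : ℕ) : Finset (Fin 3 → ℕ) :=
  (Fintype.piFinset fun _ => Finset.range (k + 1)).filter fun m => ∑ s, m s ≤ k

theorem mem_integrableIrreps (k : ℕ) (m : Fin 3 → ℕ) :
    m ∈ integrableIrreps k ↔ rootPairing (toWeight m) 0 3 ≤ (k : ℤ) := by
  simp [integrableIrreps, rootPairing, toWeight, Fin.sum_univ_succ,
    Fin.forall_fin_succ, Fin.lt_def]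
  omega

/-- The root of unity `q = exp(iπ/(k+4))`. -/
noncomputable def q (k : ℕ) : ℂ := Complex.exp (Complex.I * Real.pi / ((k : ℂ) + 4))

/-- The `q`-number `n_q = (qⁿ - q⁻ⁿ) / (q - q⁻¹)`. -/
noncomputable def qNumber (q : ℂ) (n : ℤ) : ℂ := (q ^ n - q ^ (-n)) / (q - q⁻¹)

/-- The quantum dimension of the irreducible representation of highest weight `m` at level `k`,
by the quantum Weyl formula `∏_{α > 0} ⟨m + ρ, α⟩_q / ⟨ρ, α⟩_q`. -/
noncomputable def quantumDim (k : ℕ) (m : Fin 3 → ℕ) : ℂ :=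
  ∏ p ∈ positiveRoots,
    qNumber (q k) (rootPairing (toWeight m + rho) p.1 p.2) /
      qNumber (q k) (rootPairing rho p.1 p.2)

/-- The quantum cardinality `|A_k(SU(4))|`: the sum of the squares of the quantum dimensions of
the integrable irreducible representations at level `k`. -/
noncomputable def quantumCardinality (k : ℕ) : ℂ :=
  ∑ m ∈ integrableIrreps k, quantumDim k m ^ 2

/-- The action of the Weyl group `S₄` on `ℝ⁴` by permutation of the coordinates. -/
def weylAct (w : Equiv.Perm (Fin 4)) (x : Fin 4 → ℝ) : Fin 4 → ℝ := fun a => x (w⁻¹ a)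

/-- The entries `s_{mn}` of the modular generator `s` of `SU(4)` at level `k` (Kac–Peterson
formula with dual Coxeter number `g = 4` and rank `r = 3`). -/
noncomputable def modularS (k : ℕ) (m n : Fin 3 → ℕ) : ℂ :=
  Complex.I ^ (3 * 4 / 2 : ℕ) * (Real.sqrt Q.det : ℂ) /
      (((4 + (k : ℝ)) ^ (3 / 2 : ℝ) : ℝ) : ℂ) *
    ∑ w : Equiv.Perm (Fin 4), ((Equiv.Perm.sign w : ℤ) : ℂ) *
      Complex.exp (-(2 * Complex.I * Real.pi *
        (dot (weylAct w (coord (toWeight m + rho))) (coord (toWeight n + rho)) : ℂ)) /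
          (4 + (k : ℂ)))

end SU4

/-! Put N = k + 4 and ζ = q², a primitive N-th root of unity. By the Weyl formula the quantum
dimension of m is P(m)/D, where P(m) is the product of q^n - q^(-n) over the positive roots, with n
= ⟨m + ρ, α⟩, and D is the same product at ρ. The square of P(m) is a product of two Vandermonde
determinants, at the points 1, ζ^x and at their inverses, x being the partial sums of the shifted
labels; these x run over the increasing triples in 1, …, N - 1.

The Vandermonde product is symmetric in x and vanishes on degenerate tuples, so the sum over irreps
is 1/3! of the sum over all triples modulo N. Expanding both determinants and using orthogonality of
characters gives 4! N³ for the latter, hence ∑ P(m)² = 4N³ and the cardinality is 4N³/D². The Weyl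
denominator formula turns the alternating sum in s₀₀ into D, so s₀₀² = D²/(4N³). -/

namespace SU4

open Finset Matrix

/-! ### Vandermonde determinants at roots of unity -/

section Vandermonde

variable {K : Type*} [Field K]

/-- Orthogonality of the characters `j ↦ ζ ^ (a * j)` of the cyclic group of order `N`. -/
theorem sum_pow_mul_inv_pow {ζ : K} {N : ℕ} (hζ : IsPrimitiveRoot ζ N) {a b : ℕ}
    (ha : a < N) (hb : b < N) :
    ∑ j ∈ range N, (ζ ^ a * ζ⁻¹ ^ b) ^ j = if a = b then (N : K) else 0 := by
  have h0 : ζ ≠ 0 := hζ.ne_zero (by omega)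
  split_ifs with h
  · subst h
    simp [h0]
  · have hne : ζ ^ a * ζ⁻¹ ^ b ≠ 1 := by
      intro h1
      apply h
      apply hζ.pow_inj ha hb
      rw [inv_pow] at h1
      exact (mul_inv_eq_one₀ (pow_ne_zero _ h0)).1 h1
    have h2 := mul_geom_sum (ζ ^ a * ζ⁻¹ ^ b) N
    have h3 : (ζ ^ a * ζ⁻¹ ^ b) ^ N = 1 := by
      rw [mul_pow, ← pow_mul, ← pow_mul, mul_comm a, mul_comm b, pow_mul, pow_mul, inv_pow,
        hζ.pow_eq_one]
      simp
    rw [h3, sub_self] at h2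
    exact (mul_eq_zero.1 h2).resolve_left (sub_ne_zero.2 hne)

/-- The Vandermonde determinant of the points `1, ζ ^ x₀, …, ζ ^ xₙ₋₁`. -/
def rootVandermonde {n : ℕ} (ζ : K) (x : Fin n → ℕ) : K :=
  (vandermonde (Fin.cons 1 (fun i => ζ ^ x i) : Fin (n + 1) → K)).det

theorem rootVandermonde_eq_sum {n : ℕ} (ζ : K) (x : Fin n → ℕ) :
    rootVandermonde ζ x = ∑ σ : Equiv.Perm (Fin (n + 1)), ((Equiv.Perm.sign σ : ℤ) : K) *
      ∏ i : Fin n, (ζ ^ (σ i.succ : ℕ)) ^ x i := by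
  rw [rootVandermonde, ← det_transpose, det_apply']
  refine sum_congr rfl fun σ _ => ?_
  rw [Fin.prod_univ_succ]
  simp only [transpose_apply, vandermonde_apply]
  simp [← pow_mul, mul_comm]

/-- Two points coincide: either two of the ζ ^ x i, or one of them and the leading 1. -/
theorem rootVandermonde_eq_zero {n : ℕ} {ζ : K} {x : Fin n → ℕ}
    (h : ¬ (Function.Injective x ∧ ∀ i, x i ≠ 0)) : rootVandermonde ζ x = 0 := by
  rw [rootVandermonde, det_vandermonde_eq_zero_iff]
  by_cases hx : Function.Injective x
  · obtain ⟨i, hi⟩ : ∃ i, x i = 0 := by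
      by_contra! hc
      exact h ⟨hx, hc⟩
    exact ⟨i.succ, 0, by simp [hi], Fin.succ_ne_zero i⟩
  · simp only [Function.Injective, not_forall] at hx
    obtain ⟨i, j, hij, hne⟩ := hx
    exact ⟨i.succ, j.succ, by simp [hij], by simpa using hne⟩

theorem rootVandermonde_comp {n : ℕ} (ζ : K) (x : Fin n → ℕ) (σ : Equiv.Perm (Fin n)) :
    rootVandermonde ζ (x ∘ σ) = ((Equiv.Perm.sign σ : ℤ) : K) * rootVandermonde ζ x := by
  have h : (vandermonde (Fin.cons 1 (fun i => ζ ^ (x ∘ σ) i) : Fin (n + 1) → K)) =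
      (vandermonde (Fin.cons 1 (fun i => ζ ^ x i) : Fin (n + 1) → K)).submatrix
        (Equiv.Perm.decomposeFin.symm (0, σ)) id := by
    ext i j
    simp only [submatrix_apply, vandermonde_apply]
    refine Fin.cases ?_ (fun i => ?_) i <;> simp
  rw [rootVandermonde, h, det_permute, Equiv.Perm.decomposeFin.symm_sign]
  simp [rootVandermonde]

/-- On the unit circle this is the squared modulus of the Vandermonde determinant. -/
def rootVandermondeSq {n : ℕ} (ζ : K) (x : Fin n → ℕ) : K :=
  rootVandermonde ζ x * rootVandermonde ζ⁻¹ x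

theorem rootVandermondeSq_comp {n : ℕ} (ζ : K) (x : Fin n → ℕ) (σ : Equiv.Perm (Fin n)) :
    rootVandermondeSq ζ (x ∘ σ) = rootVandermondeSq ζ x := by
  have h : ((Equiv.Perm.sign σ : ℤ) : K) * ((Equiv.Perm.sign σ : ℤ) : K) = 1 := by
    rw [← Int.cast_mul]
    simp
  rw [rootVandermondeSq, rootVandermonde_comp, rootVandermonde_comp, mul_mul_mul_comm, h, one_mul,
    rootVandermondeSq]

/-- Leibniz expansion makes each pair (σ, τ) a product of geometric sums, one per coordinate. Since
`n < N`, the exponents 0, …, n are distinct modulo N, so only the (n + 1)! diagonal pairs survive.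
-/
theorem sum_rootVandermondeSq {n N : ℕ} {ζ : K} (hζ : IsPrimitiveRoot ζ N) (hN : n < N) :
    ∑ x ∈ Fintype.piFinset (fun _ : Fin n => range N), rootVandermondeSq ζ x =
      ((n + 1).factorial : K) * (N : K) ^ n := by
  have key : ∀ σ τ : Equiv.Perm (Fin (n + 1)),
      ∑ x ∈ Fintype.piFinset (fun _ : Fin n => range N),
        (((Equiv.Perm.sign σ : ℤ) : K) * ∏ i : Fin n, (ζ ^ (σ i.succ : ℕ)) ^ x i) *
        (((Equiv.Perm.sign τ : ℤ) : K) * ∏ i : Fin n, (ζ⁻¹ ^ (τ i.succ : ℕ)) ^ x i) =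
      if σ = τ then (N : K) ^ n else 0 := by
    intro σ τ
    have h1 : ∀ x : Fin n → ℕ,
        (((Equiv.Perm.sign σ : ℤ) : K) * ∏ i : Fin n, (ζ ^ (σ i.succ : ℕ)) ^ x i) *
        (((Equiv.Perm.sign τ : ℤ) : K) * ∏ i : Fin n, (ζ⁻¹ ^ (τ i.succ : ℕ)) ^ x i) =
        (((Equiv.Perm.sign σ : ℤ) : K) * ((Equiv.Perm.sign τ : ℤ) : K)) *
          ∏ i : Fin n, (ζ ^ (σ i.succ : ℕ) * ζ⁻¹ ^ (τ i.succ : ℕ)) ^ x i := by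
      intro x
      simp only [mul_pow, prod_mul_distrib]
      ring
    simp only [h1]
    rw [← mul_sum, sum_prod_piFinset (range N)
      fun i j => (ζ ^ (σ (Fin.succ i) : ℕ) * ζ⁻¹ ^ (τ i.succ : ℕ)) ^ j]
    have h2 : ∀ i : Fin n,
        ∑ j ∈ range N, (ζ ^ (σ (Fin.succ i) : ℕ) * ζ⁻¹ ^ (τ i.succ : ℕ)) ^ j =
          if σ i.succ = τ i.succ then (N : K) else 0 := by
      intro i
      rw [sum_pow_mul_inv_pow hζ (by omega) (by omega)]
      simp only [Fin.ext_iff]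
    simp only [h2]
    split_ifs with h
    · subst h
      rw [← Int.cast_mul]
      simp
    · obtain ⟨i, hi⟩ : ∃ i : Fin n, σ i.succ ≠ τ i.succ := by
        by_contra! hc
        apply h
        -- A permutation fixing every nonzero index also fixes 0, so agreement on successors is
        -- enough.
        have h3 : ∀ j, j ≠ 0 → (τ⁻¹ * σ) j = j := by
          intro j hj
          obtain ⟨i, rfl⟩ := Fin.exists_succ_eq.2 hj
          simp [hc i]
        have h4 : (τ⁻¹ * σ) 0 = 0 := by
          by_contra h0
          exact h0 ((τ⁻¹ * σ).injective (h3 _ h0))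
        have h5 : τ⁻¹ * σ = 1 := by
          ext j
          by_cases hj : j = 0
          · rw [hj, h4]; rfl
          · rw [h3 j hj]; rfl
        exact (inv_mul_eq_one.1 h5).symm
      rw [prod_eq_zero (mem_univ i) (by simp [hi]), mul_zero]
  simp only [rootVandermondeSq, rootVandermonde_eq_sum, sum_mul_sum]
  rw [sum_comm]
  simp_rw [sum_comm (s := Fintype.piFinset _), key]
  simp [Fintype.card_perm]

end Vandermonde

/-! ### From all tuples to the Weyl alcove -/

/-- Summation over the chamber of strictly increasing tuples for a symmetric function that
vanishes on tuples with a repeated entry. -/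
theorem sum_piFinset_eq_factorial_mul {R : Type*} [CommSemiring R] {n N : ℕ}
    (f : (Fin n → ℕ) → R) (hsymm : ∀ x (σ : Equiv.Perm (Fin n)), f (x ∘ σ) = f x)
    (hinj : ∀ x, ¬ Function.Injective x → f x = 0) :
    ∑ x ∈ Fintype.piFinset (fun _ : Fin n => range N), f x =
      (n.factorial : R) *
        ∑ x ∈ Fintype.piFinset (fun _ : Fin n => range N) with StrictMono x, f x := by
  classical
  -- An injective tuple is made increasing by exactly one permutation.
  have h1 : ∀ x : Fin n → ℕ,
      f x = ∑ σ : Equiv.Perm (Fin n), if StrictMono (x ∘ σ) then f x else 0 := by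
    intro x
    by_cases hx : Function.Injective x
    · rw [sum_eq_single (Tuple.sort x)]
      · rw [if_pos]
        exact (Tuple.monotone_sort x).strictMono_of_injective (hx.comp (Equiv.injective _))
      · intro σ _ hσ
        rw [if_neg]
        intro hm
        apply hσ
        ext i
        have := congrFun (Tuple.unique_monotone hm.monotone (Tuple.monotone_sort x)) i
        rw [hx this]
      · simp
    · simp [hinj x hx]
  have h2 : ∀ σ : Equiv.Perm (Fin n),
      ∑ x ∈ Fintype.piFinset (fun _ : Fin n => range N),
        (if StrictMono (x ∘ σ) then f x else 0) =
      ∑ x ∈ Fintype.piFinset (fun _ : Fin n => range N) with StrictMono x, f x := by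
    intro σ
    rw [sum_filter]
    refine sum_nbij' (fun x => x ∘ σ) (fun x => x ∘ σ.symm) ?_ ?_ ?_ ?_ ?_
    · intro x hx
      simp only [Fintype.mem_piFinset] at hx ⊢
      exact fun i => hx _
    · intro x hx
      simp only [Fintype.mem_piFinset] at hx ⊢
      exact fun i => hx _
    · intro x _
      ext i
      simp
    · intro x _
      ext i
      simp
    · intro x _
      simp only [hsymm]
  rw [sum_congr rfl fun x _ => h1 x, sum_comm, sum_congr rfl fun σ _ => h2 σ]
  simp [Fintype.card_perm]

/-- Each label is a gap between consecutive entries of 0, x 0, x 1, x 2, minus 1 for the ρ-shift;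
the bound x 2 < k + 4 becomes the level condition. -/
theorem sum_chamber_eq_sum_integrableIrreps {R : Type*} [AddCommMonoid R] (k : ℕ)
    (f : (Fin 3 → ℕ) → R) (hf : ∀ x, (∃ i, x i = 0) → f x = 0) :
    ∑ x ∈ Fintype.piFinset (fun _ : Fin 3 => range (k + 4)) with StrictMono x, f x =
      ∑ m ∈ integrableIrreps k, f ![m 2 + 1, m 1 + m 2 + 2, m 0 + m 1 + m 2 + 3] := by
  classical
  rw [← sum_filter_of_ne (p := fun x => x 0 ≠ 0) fun x _ h h0 => h (hf x ⟨0, h0⟩)]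
  refine sum_nbij' (fun x => ![x 2 - x 1 - 1, x 1 - x 0 - 1, x 0 - 1])
    (fun m => ![m 2 + 1, m 1 + m 2 + 2, m 0 + m 1 + m 2 + 3]) ?_ ?_ ?_ ?_ ?_ <;>
    simp only [mem_filter, Fintype.mem_piFinset, mem_range, Fin.forall_fin_succ, integrableIrreps,
      Fin.strictMono_iff_lt_succ, Fin.sum_univ_three, funext_iff]
  all_goals simp
  · omega
  · omega
  · omega
  · omega
  · intro x _ _ _ _ _ _
    congr 1
    funext i
    fin_cases i <;> simp <;> omega

/-! ### Weyl numerators and quantum dimensions -/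

theorem prod_positiveRoots {R : Type*} [CommMonoid R] (f : Fin 4 → Fin 4 → R) :
    ∏ p ∈ positiveRoots, f p.1 p.2 = f 0 1 * f 0 2 * f 0 3 * f 1 2 * f 1 3 * f 2 3 := by
  have h : positiveRoots = {(0, 1), (0, 2), (0, 3), (1, 2), (1, 3), (2, 3)} := by decide
  rw [h]
  simp [mul_assoc]

theorem det_vandermonde_four {R : Type*} [CommRing R] (v : Fin 4 → R) :
    (vandermonde v).det = (v 1 - v 0) * (v 2 - v 0) * (v 3 - v 0) * (v 2 - v 1) * (v 3 - v 1) *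
      (v 3 - v 2) := by
  have h0 : Ioi (0 : Fin 4) = {1, 2, 3} := by decide
  have h1 : Ioi (1 : Fin 4) = {2, 3} := by decide
  have h2 : Ioi (2 : Fin 4) = {3} := by decide
  have h3 : Ioi (3 : Fin 4) = ∅ := by decide
  rw [det_vandermonde, Fin.prod_univ_four, h0, h1, h2, h3]
  simp [mul_assoc]

/-- The numerator `qⁿ - q⁻ⁿ` of the `q`-number `n_q`. -/
noncomputable def qDiff (q : ℂ) (n : ℤ) : ℂ := q ^ n - q ^ (-n)

/-- Since q^(2u) - q^(2v) = q^(u+v) (q^(u-v) - q^(v-u)), the prefactors cancel against those at q⁻¹,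
and the six signs multiply to 1. -/
theorem rootVandermondeSq_sq {q : ℂ} (hq : q ≠ 0) (m : Fin 3 → ℕ) :
    rootVandermondeSq (q ^ 2) ![m 2 + 1, m 1 + m 2 + 2, m 0 + m 1 + m 2 + 3] =
      (∏ p ∈ positiveRoots, qDiff q (rootPairing (toWeight m + rho) p.1 p.2)) ^ 2 := by
  rw [prod_positiveRoots fun a b => qDiff q (rootPairing (toWeight m + rho) a b)]
  have e : ∀ a : Fin 4, ∀ b : Fin 4, rootPairing (toWeight m + rho) a b =
      ∑ s : Fin 3, if a ≤ s.castSucc ∧ s.castSucc < b then ((m s + 1 : ℕ) : ℤ) else 0 := by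
    intro a b
    simp [rootPairing, sum_filter, toWeight, rho]
  have e01 : rootPairing (toWeight m + rho) 0 1 = ((m 0 + 1 : ℕ) : ℤ) := by
    rw [e]; simp [Fin.lt_def]
  have e12 : rootPairing (toWeight m + rho) 1 2 = ((m 1 + 1 : ℕ) : ℤ) := by
    rw [e]; simp [Fin.sum_univ_three, Fin.le_def, Fin.lt_def]
  have e23 : rootPairing (toWeight m + rho) 2 3 = ((m 2 + 1 : ℕ) : ℤ) := by
    rw [e]; simp [Fin.sum_univ_three, Fin.le_def, Fin.lt_def]
  have e02 : rootPairing (toWeight m + rho) 0 2 = ((m 0 + 1 + (m 1 + 1) : ℕ) : ℤ) := by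
    rw [e]; simp [Fin.sum_univ_three, Fin.lt_def]
  have e13 : rootPairing (toWeight m + rho) 1 3 = ((m 1 + 1 + (m 2 + 1) : ℕ) : ℤ) := by
    rw [e]; simp [Fin.sum_univ_three, Fin.le_def, Fin.lt_def]
  have e03 : rootPairing (toWeight m + rho) 0 3 =
      ((m 0 + 1 + (m 1 + 1) + (m 2 + 1) : ℕ) : ℤ) := by
    rw [e]; simp [Fin.sum_univ_three, Fin.lt_def]
  rw [e01, e02, e03, e12, e13, e23]
  obtain ⟨a, ha⟩ : ∃ a, a = m 0 + 1 := ⟨_, rfl⟩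
  obtain ⟨b, hb⟩ : ∃ b, b = m 1 + 1 := ⟨_, rfl⟩
  obtain ⟨c, hc⟩ : ∃ c, c = m 2 + 1 := ⟨_, rfl⟩
  have h1 : m 1 + m 2 + 2 = b + c := by omega
  have h2 : m 0 + m 1 + m 2 + 3 = a + b + c := by omega
  rw [h1, h2, ← ha, ← hb, ← hc]
  have hA := pow_ne_zero a hq
  have hB := pow_ne_zero b hq
  have hC := pow_ne_zero c hq
  have hv : ∀ z : ℂ, rootVandermonde z ![c, b + c, a + b + c] =
      (z ^ c - 1) * (z ^ (b + c) - 1) * (z ^ (a + b + c) - 1) * (z ^ (b + c) - z ^ c) *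
        (z ^ (a + b + c) - z ^ c) * (z ^ (a + b + c) - z ^ (b + c)) := fun z =>
    det_vandermonde_four _
  simp only [rootVandermondeSq, hv, qDiff, _root_.zpow_neg, zpow_natCast, inv_pow, ← pow_mul,
    mul_comm 2]
  simp only [pow_mul, pow_add]
  field_simp
  ring

theorem q_ne_zero (k : ℕ) : q k ≠ 0 := Complex.exp_ne_zero _

theorem q_zpow (k : ℕ) (n : ℤ) :
    q k ^ n = Complex.exp (((n * (Real.pi / (k + 4)) : ℝ) : ℂ) * Complex.I) := by
  rw [q, ← Complex.exp_int_mul]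
  congr 1
  push_cast
  ring

theorem qDiff_q (k : ℕ) (n : ℤ) :
    qDiff (q k) n = 2 * Complex.I * (Real.sin (n * (Real.pi / (k + 4))) : ℂ) := by
  rw [qDiff, q_zpow, q_zpow, Complex.ofReal_sin, Complex.sin]
  have h : (((((-n : ℤ) : ℝ) * (Real.pi / (k + 4)) : ℝ)) : ℂ) =
      -((n * (Real.pi / (k + 4)) : ℝ) : ℂ) := by
    push_cast
    ring
  rw [h]
  linear_combination (Complex.exp (((n * (Real.pi / (k + 4)) : ℝ) : ℂ) * Complex.I) -
    Complex.exp (-((n * (Real.pi / (k + 4)) : ℝ) : ℂ) * Complex.I)) * Complex.I_mul_I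

theorem sin_mul_pos (k : ℕ) {n : ℤ} (h0 : 0 < n) (h4 : n < 4) :
    0 < Real.sin (n * (Real.pi / (k + 4))) := by
  have hk : (0 : ℝ) < k + 4 := by positivity
  have h0' : (0 : ℝ) < n := by exact_mod_cast h0
  have h4' : (n : ℝ) < 4 := by exact_mod_cast h4
  have hπ := Real.pi_pos
  apply Real.sin_pos_of_pos_of_lt_pi
  · positivity
  · rw [← mul_div_assoc, div_lt_iff₀ hk]
    nlinarith [mul_nonneg hπ.le (Nat.cast_nonneg k : (0 : ℝ) ≤ k)]

theorem qDiff_q_ne_zero (k : ℕ) {n : ℤ} (h0 : 0 < n) (h4 : n < 4) : qDiff (q k) n ≠ 0 := by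
  rw [qDiff_q]
  have := (sin_mul_pos k h0 h4).ne'
  simp only [ne_eq, mul_eq_zero, OfNat.ofNat_ne_zero, Complex.I_ne_zero, Complex.ofReal_eq_zero,
    this, or_self, not_false_eq_true]

theorem isPrimitiveRoot_q_sq (k : ℕ) : IsPrimitiveRoot (q k ^ 2) (k + 4) := by
  have h := Complex.isPrimitiveRoot_exp (k + 4) (by omega)
  convert h using 1
  rw [q, ← Complex.exp_nat_mul]
  congr 1
  push_cast
  ring

/-- The sum of the squared Weyl numerators over the integrable irreps. -/
theorem sum_prod_qDiff_sq (k : ℕ) :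
    ∑ m ∈ integrableIrreps k,
      (∏ p ∈ positiveRoots, qDiff (q k) (rootPairing (toWeight m + rho) p.1 p.2)) ^ 2 =
      4 * ((k : ℂ) + 4) ^ 3 := by
  have hzero : ∀ x : Fin 3 → ℕ, ¬ (Function.Injective x ∧ ∀ i, x i ≠ 0) →
      rootVandermondeSq (q k ^ 2) x = 0 := fun x hx => by
    rw [rootVandermondeSq, rootVandermonde_eq_zero hx, zero_mul]
  have h := sum_rootVandermondeSq (n := 3) (isPrimitiveRoot_q_sq k) (by omega)
  rw [sum_piFinset_eq_factorial_mul _ (rootVandermondeSq_comp _)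
    (fun x hx => hzero x fun h => hx h.1),
    sum_chamber_eq_sum_integrableIrreps k _ (fun x ⟨i, hi⟩ => hzero x fun h => h.2 i hi)] at h
  simp only [rootVandermondeSq_sq (q_ne_zero k)] at h
  have h6 : ((Nat.factorial 3 : ℕ) : ℂ) = 6 := by norm_num [Nat.factorial]
  have h24 : ((Nat.factorial (3 + 1) : ℕ) : ℂ) = 24 := by norm_num [Nat.factorial]
  rw [h6, h24] at h
  push_cast at h
  linear_combination h / 6

/-- The Weyl denominator at `ρ`. -/
theorem prod_qDiff_rho (z : ℂ) :
    ∏ p ∈ positiveRoots, qDiff z (rootPairing rho p.1 p.2) =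
      qDiff z 1 ^ 3 * qDiff z 2 ^ 2 * qDiff z 3 := by
  rw [prod_positiveRoots fun a b => qDiff z (rootPairing rho a b)]
  have e01 : rootPairing rho 0 1 = 1 := by decide
  have e12 : rootPairing rho 1 2 = 1 := by decide
  have e23 : rootPairing rho 2 3 = 1 := by decide
  have e02 : rootPairing rho 0 2 = 2 := by decide
  have e13 : rootPairing rho 1 3 = 2 := by decide
  have e03 : rootPairing rho 0 3 = 3 := by decide
  rw [e01, e02, e03, e12, e13, e23]
  ring

theorem quantumDim_eq (k : ℕ) (m : Fin 3 → ℕ) :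
    quantumDim k m =
      (∏ p ∈ positiveRoots, qDiff (q k) (rootPairing (toWeight m + rho) p.1 p.2)) /
        (qDiff (q k) 1 ^ 3 * qDiff (q k) 2 ^ 2 * qDiff (q k) 3) := by
  have h1 : q k - (q k)⁻¹ ≠ 0 := by
    simpa [qDiff] using qDiff_q_ne_zero k (n := 1) (by norm_num) (by norm_num)
  rw [← prod_qDiff_rho, ← prod_div_distrib, quantumDim]
  refine prod_congr rfl fun p _ => ?_
  rw [qNumber, qNumber, div_div_div_cancel_right₀ h1, qDiff, qDiff]

theorem quantumCardinality_eq (k : ℕ) :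
    quantumCardinality k =
      4 * ((k : ℂ) + 4) ^ 3 / (qDiff (q k) 1 ^ 3 * qDiff (q k) 2 ^ 2 * qDiff (q k) 3) ^ 2 := by
  simp only [quantumCardinality, quantumDim_eq, div_pow]
  rw [← sum_div, sum_prod_qDiff_sq]

/-! ### The modular matrix entry s₀₀ -/

theorem coord_rho (a : Fin 4) : coord rho a = 3 / 2 - (a : ℕ) := by
  rw [coord, sum_filter, Fin.sum_univ_three, Fin.sum_univ_three]
  fin_cases a <;> simp [rho, Fin.le_def] <;> norm_num

theorem det_Q : Q.det = 1 / 4 := by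
  rw [Q, det_fin_three]
  simp
  norm_num

/-- The Weyl denominator formula at `ρ`. -/
theorem sum_sign_exp_eq (k : ℕ) :
    ∑ w : Equiv.Perm (Fin 4), ((Equiv.Perm.sign w : ℤ) : ℂ) *
      Complex.exp (-(2 * Complex.I * Real.pi *
        (dot (weylAct w (coord rho)) (coord rho) : ℂ)) / (4 + (k : ℂ))) =
      qDiff (q k) 1 ^ 3 * qDiff (q k) 2 ^ 2 * qDiff (q k) 3 := by
  have hq := q_ne_zero k
  have hk : (k : ℂ) + 4 ≠ 0 := by exact_mod_cast (by omega : k + 4 ≠ 0)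
  have hk' : 4 + (k : ℂ) ≠ 0 := by rwa [add_comm]
  have hdet : ∑ w : Equiv.Perm (Fin 4), ((Equiv.Perm.sign w : ℤ) : ℂ) *
      Complex.exp (-(2 * Complex.I * Real.pi *
        (dot (weylAct w (coord rho)) (coord rho) : ℂ)) / (4 + (k : ℂ))) =
      (vandermonde fun b : Fin 4 => q k ^ (3 - 2 * (b : ℤ))).det := by
    -- The nodes are q^(2 ρ_b), with ρ_b = 3/2 - b; passing to w⁻¹ undoes the inverse in `weylAct`.
    rw [← det_transpose, det_apply', ← Equiv.sum_comp (Equiv.inv (Equiv.Perm (Fin 4)))]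
    refine sum_congr rfl fun w _ => ?_
    have h1 : ∀ a : Fin 4,
        (vandermonde fun b : Fin 4 => q k ^ (3 - 2 * (b : ℤ)))ᵀ (w a) a =
          Complex.exp (Complex.I * Real.pi / (k + 4) *
            (((3 - 2 * (a : ℤ)) * (w a : ℕ) : ℤ) : ℂ)) := by
      intro a
      rw [transpose_apply, vandermonde_apply, ← zpow_natCast, ← _root_.zpow_mul, q,
        ← Complex.exp_int_mul, mul_comm]
    simp only [h1, ← Complex.exp_sum, Equiv.inv_apply, Equiv.Perm.sign_inv]
    congr 2
    -- As ρ has coordinate sum 0, the shift by 3/2 between ρ and the Vandermonde exponents drops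
    -- out.
    have h2 : ∑ a : Fin 4, (3 - 2 * ((a : ℕ) : ℂ)) = 0 := by
      rw [Fin.sum_univ_four]
      simp
      norm_num
    simp only [dot, weylAct, coord_rho, inv_inv]
    rw [neg_div, ← mul_sum]
    push_cast
    have h3 : ∑ a : Fin 4, ((3 : ℂ) / 2 - ((w a : ℕ) : ℂ)) * (3 / 2 - ((a : ℕ) : ℂ)) =
        -(1 / 2) * ∑ a : Fin 4, (3 - 2 * ((a : ℕ) : ℂ)) * ((w a : ℕ) : ℂ) +
          3 / 4 * ∑ a : Fin 4, (3 - 2 * ((a : ℕ) : ℂ)) := by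
      rw [mul_sum, mul_sum, ← sum_add_distrib]
      refine sum_congr rfl fun a _ => ?_
      ring
    rw [h3, h2]
    field_simp
    ring
  rw [hdet, det_vandermonde_four]
  have e0 : q k ^ (3 - 2 * (((0 : Fin 4) : ℕ) : ℤ)) = q k ^ 3 := by norm_cast
  have e1 : q k ^ (3 - 2 * (((1 : Fin 4) : ℕ) : ℤ)) = q k := by norm_num
  have e2 : q k ^ (3 - 2 * (((2 : Fin 4) : ℕ) : ℤ)) = (q k)⁻¹ := by norm_num
  have e3 : q k ^ (3 - 2 * (((3 : Fin 4) : ℕ) : ℤ)) = (q k ^ 3)⁻¹ := by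
    rw [← zpow_natCast, ← _root_.zpow_neg]; norm_num
  have d1 : qDiff (q k) 1 = q k - (q k)⁻¹ := by simp [qDiff]
  have d2 : qDiff (q k) 2 = q k ^ 2 - (q k ^ 2)⁻¹ := by
    rw [qDiff, _root_.zpow_neg]; norm_cast
  have d3 : qDiff (q k) 3 = q k ^ 3 - (q k ^ 3)⁻¹ := by
    rw [qDiff, _root_.zpow_neg]; norm_cast
  rw [e0, e1, e2, e3, d1, d2, d3]
  field_simp
  ring

theorem modularS_zero_zero_sq (k : ℕ) :
    modularS k 0 0 ^ 2 =
      (qDiff (q k) 1 ^ 3 * qDiff (q k) 2 ^ 2 * qDiff (q k) 3) ^ 2 / (4 * ((k : ℂ) + 4) ^ 3) := by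
  have h0 : toWeight 0 + rho = rho := by
    ext s
    simp [toWeight]
  have hpow : ((((4 + (k : ℝ)) ^ (3 / 2 : ℝ) : ℝ) : ℂ)) ^ 2 = ((k : ℂ) + 4) ^ 3 := by
    have : ((4 + (k : ℝ)) ^ (3 / 2 : ℝ)) ^ 2 = ((k : ℝ) + 4) ^ 3 := by
      rw [← Real.rpow_natCast, ← Real.rpow_mul (by positivity), add_comm, ← Real.rpow_natCast]
      norm_num
    exact_mod_cast this
  have hsqrt : ((Real.sqrt Q.det : ℝ) : ℂ) ^ 2 = 1 / 4 := by
    have : Real.sqrt Q.det ^ 2 = 1 / 4 := by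
      rw [Real.sq_sqrt (by rw [det_Q]; norm_num), det_Q]
    rw [← Complex.ofReal_pow, this]
    norm_num
  have hI : (Complex.I ^ (3 * 4 / 2 : ℕ)) ^ 2 = 1 := by
    rw [← pow_mul, show 3 * 4 / 2 * 2 = 4 * 3 from rfl, pow_mul, Complex.I_pow_four, one_pow]
  rw [modularS, h0, sum_sign_exp_eq, mul_pow, div_pow, mul_pow, hpow, hsqrt, hI]
  rw [one_mul, div_div, div_mul_eq_mul_div, one_mul]

/-! ### Trigonometric form and special values -/

theorem weylDenominator_sq (k : ℕ) :
    (qDiff (q k) 1 ^ 3 * qDiff (q k) 2 ^ 2 * qDiff (q k) 3) ^ 2 =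
      ((2 ^ 16 * Real.cos (Real.pi / ((k : ℝ) + 4)) ^ 4 *
            (2 * Real.cos (2 * Real.pi / ((k : ℝ) + 4)) + 1) ^ 2 *
            Real.sin (Real.pi / ((k : ℝ) + 4)) ^ 12 : ℝ) : ℂ) := by
  rw [qDiff_q, qDiff_q, qDiff_q, mul_div_assoc]
  set x := Real.pi / ((k : ℝ) + 4)
  have h3 : Real.sin (3 * x) = Real.sin x * (2 * Real.cos (2 * x) + 1) := by
    rw [Real.sin_three_mul, Real.cos_two_mul]
    linear_combination (-4 * Real.sin x) * Real.sin_sq_add_cos_sq x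
  have e1 : ((1 : ℤ) : ℝ) * x = x := by simp
  have e2 : ((2 : ℤ) : ℝ) * x = 2 * x := by simp
  have e3 : ((3 : ℤ) : ℝ) * x = 3 * x := by simp
  rw [e1, e2, e3, h3, Real.sin_two_mul]
  push_cast
  have hI : Complex.I ^ 12 = 1 := by
    rw [show 12 = 4 * 3 from rfl, pow_mul, Complex.I_pow_four, one_pow]
  ring_nf
  rw [hI]
  ring

theorem quantumCardinality_eq_trig (k : ℕ) :
    quantumCardinality k =
      ((4 * ((k : ℝ) + 4) ^ 3 /
        (2 ^ 16 * Real.cos (Real.pi / ((k : ℝ) + 4)) ^ 4 *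
          (2 * Real.cos (2 * Real.pi / ((k : ℝ) + 4)) + 1) ^ 2 *
          Real.sin (Real.pi / ((k : ℝ) + 4)) ^ 12) : ℝ) : ℂ) := by
  rw [quantumCardinality_eq, weylDenominator_sq, Complex.ofReal_div]
  push_cast
  rfl

/-- Only even powers of sin and cos occur, so half-angle formulas leave a polynomial in c. The
division-free `hA` also forces the denominator to be nonzero, its right side being positive. -/
theorem quantumCardinality_eq_of_cos {k : ℕ} {c A : ℝ}
    (hc : Real.cos (2 * Real.pi / ((k : ℝ) + 4)) = c)
    (hA : A * (2 ^ 8 * (1 + c) ^ 2 * (2 * c + 1) ^ 2 * (1 - c) ^ 6) = 4 * ((k : ℝ) + 4) ^ 3) :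
    quantumCardinality k = (A : ℂ) := by
  rw [quantumCardinality_eq_trig, hc]
  congr 1
  have hC : Real.cos (Real.pi / ((k : ℝ) + 4)) ^ 2 = (1 + c) / 2 := by
    rw [← hc, mul_div_assoc, Real.cos_two_mul]
    ring
  have hS : Real.sin (Real.pi / ((k : ℝ) + 4)) ^ 2 = (1 - c) / 2 := by
    rw [Real.sin_sq, hC]
    ring
  have hD : 2 ^ 16 * Real.cos (Real.pi / ((k : ℝ) + 4)) ^ 4 * (2 * c + 1) ^ 2 *
      Real.sin (Real.pi / ((k : ℝ) + 4)) ^ 12 =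
      2 ^ 8 * (1 + c) ^ 2 * (2 * c + 1) ^ 2 * (1 - c) ^ 6 := by
    rw [show 4 = 2 * 2 from rfl, show 12 = 2 * 6 from rfl, pow_mul, pow_mul, hC, hS]
    ring
  rw [hD, ← hA, mul_div_cancel_right₀]
  intro h0
  rw [h0, mul_zero] at hA
  have : (0 : ℝ) < 4 * ((k : ℝ) + 4) ^ 3 := by positivity
  exact this.ne hA

end SU4

theorem mainTheorem3 :
    (∀ k : ℕ,
      SU4.quantumCardinality k = 1 / SU4.modularS k 0 0 ^ 2 ∧
      SU4.quantumCardinality k =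
        ((4 * ((k : ℝ) + 4) ^ 3 /
          (2 ^ 16 * Real.cos (Real.pi / ((k : ℝ) + 4)) ^ 4 *
            (2 * Real.cos (2 * Real.pi / ((k : ℝ) + 4)) + 1) ^ 2 *
            Real.sin (Real.pi / ((k : ℝ) + 4)) ^ 12) : ℝ) : ℂ)) ∧
    SU4.quantumCardinality 4 = ((128 * (3 + 2 * Real.sqrt 2) : ℝ) : ℂ) ∧
    SU4.quantumCardinality 6 = ((800 * (9 + 4 * Real.sqrt 5) : ℝ) : ℂ) ∧
    SU4.quantumCardinality 8 = ((3456 * (26 + 15 * Real.sqrt 3) : ℝ) : ℂ) := by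
  refine ⟨fun k => ⟨?_, SU4.quantumCardinality_eq_trig k⟩, ?_, ?_, ?_⟩
  · rw [SU4.quantumCardinality_eq, SU4.modularS_zero_zero_sq, one_div_div]
  · apply SU4.quantumCardinality_eq_of_cos (c := Real.sqrt 2 / 2)
    · rw [← Real.cos_pi_div_four]
      congr 1
      push_cast
      ring
    · obtain ⟨r, hr⟩ : ∃ r, r = Real.sqrt 2 := ⟨_, rfl⟩
      have h : r ^ 2 = 2 := by rw [hr]; exact Real.sq_sqrt (by norm_num)
      rw [← hr]
      push_cast
      -- The coefficient is the polynomial quotient of the difference of the two sides by r² - 2;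
      -- the other two cases work likewise.
      linear_combination ((-48128) - 32768 * r + 74240 * r ^ 2 + 24576 * r ^ 3 -
          46848 * r ^ 4 - 2048 * r ^ 5 + 12416 * r ^ 6 - 1536 * r ^ 7 -
          1152 * r ^ 8 + 256 * r ^ 9) * h
  · apply SU4.quantumCardinality_eq_of_cos (c := (1 + Real.sqrt 5) / 4)
    · rw [← Real.cos_pi_div_five]
      congr 1
      push_cast
      ring
    · obtain ⟨r, hr⟩ : ∃ r, r = Real.sqrt 5 := ⟨_, rfl⟩
      have h : r ^ 2 = 5 := by rw [hr]; exact Real.sq_sqrt (by norm_num)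
      rw [← hr]
      push_cast
      linear_combination ((-7355525/32) + (1804275/16) * r + (975775/16) * r ^ 2 -
          (564975/16) * r ^ 3 - (40325/8) * r ^ 4 + (62775/16) * r ^ 5 + (1825/16) * r ^ 6 -
          (2925/16) * r ^ 7 + (25/32) * r ^ 8 + (25/8) * r ^ 9) * h
  · apply SU4.quantumCardinality_eq_of_cos (c := Real.sqrt 3 / 2)
    · rw [← Real.cos_pi_div_six]
      congr 1
      push_cast
      ring
    · obtain ⟨r, hr⟩ : ∃ r, r = Real.sqrt 3 := ⟨_, rfl⟩
      have h : r ^ 2 = 3 := by rw [hr]; exact Real.sq_sqrt (by norm_num)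
      rw [← hr]
      push_cast
      linear_combination ((-7665408) - 4423680 * r + 12780288 * r ^ 2 + 3538944 * r ^ 3 -
          8494848 * r ^ 4 - 110592 * r ^ 5 + 2329344 * r ^ 6 - 331776 * r ^ 7 -
          221184 * r ^ 8 + 51840 * r ^ 9) * h
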